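/- Let $G$ be a Hausdorff topological group acting continuously on a compact Hausdorff space $X$. Assume that $(G,X)$ is minimal (every $G$-orbit is dense) and distal (if $x,y\in X$ are proximal, i.e. for every neighbourhood $U$ of the diagonal of $X\times X$ there is $g\in G$ with $(gx,gy)\in U$, then $x=y$). Let $d\ge 1$. Let $X^{[d]}=X^{\{0,1\}^d}$ with the product topology, and for $x\in X$ let $x^{[d]}\in X^{[d]}$ be the constant configuration with all entries $x$. The group $G^{[d]}=G^{\{0,1\}^d}$ acts coordinatewise on $X^{[d]}$. For $g\in G$ and $F\subset\{0,1\}^d$ let $[g]_F\in G^{[d]}$ be $g$ on $F$ and the identity elsewhere. Let $\mathcal{HK}^{[d]}\le G^{[d]}$ be the subgroup generated by all $[g]_F$ with $g\in G$ and $F=\{\omega:\omega_i=a\}$, $1\le i\le d$, $a\in\{0,1\}$ (hyperfaces), and $\mathcal F^{[d]}$ the subgroup generated by all $[g]_F$ with $g\in G$ and $F=\{\omega:\omega_i=1\}$, $1\le i\le d$ (upper hyperfaces). Put $$C_G^{[d]}(X)=\overline{\{\gamma x^{[d]}:\gamma\in\mathcal{HK}^{[d]},\,x\in X\}},\qquad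 C_x^{[d]}(X)=\{c\in C_G^{[d]}(X): c(\vec 0)=x\},\qquad Y_x^{[d]}(X)=\overline{\mathcal F^{[d]}x^{[d]}},$$ and let $C_{x*}^{[d]}(X)$ and $Y_{x*}^{[d]}(X)$ be the images of $C_x^{[d]}(X)$ and $Y_x^{[d]}(X)$ under the projection $\pi_*:X^{\{0,1\}^d}\to X^{\{0,1\}^d\setminus\{\vec 0\}}$ that forgets the $\vec 0$-coordinate. Then for every $x\in X$ $$Y_x^{[d]}(X)=C_x^{[d]}(X),\qquad\text{and hence}\qquad Y_{x*}^{[d]}(X)=C_{x*}^{[d]}(X).$$ -/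

import Mathlib

open Topology

namespace CubeDynamics

section Combinatorics

/-- The discrete cube `{0,1}^d`; its vertex `0` is the zero vector. -/
abbrev Cube (d : ℕ) : Type := Fin d → Fin 2

/-- The set `X^[d]` of `d`-configurations, i.e. maps `{0,1}^d → X`. For a group `G`, the group
`G^[d]` (pointwise multiplication) acts coordinatewise on `X^[d]`; for a topological space `X`,
`X^[d]` carries the product topology. -/
abbrev Config (d : ℕ) (X : Type*) : Type _ := Cube d → X

/-- The constant configuration `x^[d]`. -/
def constConfig {X : Type*} (d : ℕ) (x : X) : Config d X := fun _ => x

/-- The hyperface `{ω | ω i = a}` of the discrete cube. -/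
def hyperface {d : ℕ} (i : Fin d) (a : Fin 2) : Set (Cube d) := {ω | ω i = a}

/-- The set `X_*^[d]` of configurations on `{0,1}^d ∖ {0}`. -/
abbrev PuncturedConfig (d : ℕ) (X : Type*) : Type _ := {ω : Cube d // ω ≠ 0} → X

/-- The projection `π_* : X^[d] → X_*^[d]` which forgets the `0`-coordinate. -/
def forgetZero {X : Type*} {d : ℕ} (c : Config d X) : PuncturedConfig d X := fun ω => c ω.1

open Classical in
/-- The element `[g]_F` of `G^[d]`: it is `g` on `F` and the identity off `F`. -/
noncomputable def faceElement {G : Type*} [Group G] {d : ℕ} (g : G) (F : Set (Cube d)) :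
    Config d G := fun ω => if ω ∈ F then g else 1

/-- The Host-Kra cube group `HK^[d]`, generated by all `[g]_F`, `F` a hyperface. -/
def hostKraGroup (G : Type*) [Group G] (d : ℕ) : Subgroup (Config d G) :=
  Subgroup.closure {γ | ∃ (g : G) (i : Fin d) (a : Fin 2), γ = faceElement g (hyperface i a)}

/-- The face cube group `F^[d]`, generated by all `[g]_F`, `F` an upper hyperface. -/
def faceGroup (G : Type*) [Group G] (d : ℕ) : Subgroup (Config d G) :=
  Subgroup.closure {γ | ∃ (g : G) (i : Fin d), γ = faceElement g (hyperface i 1)}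

end Combinatorics

section Dynamics

variable (G : Type*) [Group G] {X : Type*} [TopologicalSpace X] [MulAction G X]

/-- `x` and `y` are proximal: the pairs `(g x, g y)` enter every neighbourhood of the diagonal.
(On a compact Hausdorff space the neighbourhoods of the diagonal are the entourages of the unique
compatible uniformity, so this says that some net `g_i` brings `g_i x`, `g_i y` together.) -/
def Proximal (x y : X) : Prop :=
  ∀ U ∈ 𝓝ˢ (Set.diagonal X), ∃ g : G, (g • x, g • y) ∈ U

/-- `(G, X)` is distal: the proximal relation is the diagonal. -/
def IsDistal (X : Type*) [TopologicalSpace X] [MulAction G X] : Prop :=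
  {p : X × X | Proximal G p.1 p.2} = Set.diagonal X

/-- The dynamical cubes `C_G^[d](X)`: the closure of the set of all `γ x^[d]` with
`γ ∈ HK^[d]` and `x ∈ X`. -/
def dynCubes (X : Type*) [TopologicalSpace X] [MulAction G X] (d : ℕ) : Set (Config d X) :=
  closure (⋃ x : X, MulAction.orbit (hostKraGroup G d) (constConfig d x))

/-- `C_x^[d](X)`: the dynamical cubes whose `0`-vertex is `x`. -/
def cubesAt (d : ℕ) (x : X) : Set (Config d X) := dynCubes G X d ∩ {c | c 0 = x}

/-- `C_{x*}^[d](X)`, the image of `C_x^[d](X)` under `π_*`. -/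
def puncturedCubesAt (d : ℕ) (x : X) : Set (PuncturedConfig d X) := forgetZero '' cubesAt G d x

/-- `Y_x^[d](X)`: the orbit closure of `x^[d]` under the face cube group `F^[d]`. -/
def faceOrbitClosure (d : ℕ) (x : X) : Set (Config d X) :=
  closure (MulAction.orbit (faceGroup G d) (constConfig d x))

/-- `Y_{x*}^[d](X)`, the image of `Y_x^[d](X)` under `π_*`. -/
def puncturedFaceOrbitClosure (d : ℕ) (x : X) : Set (PuncturedConfig d X) :=
  forgetZero '' faceOrbitClosure G d x

end Dynamics

end CubeDynamics

namespace CubeDynamics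

/-! ### Orbit closures of coordinatewise group actions -/

section OrbitClosures

/-! The face group fixes the `0`-coordinate, so `Y_x ⊆ C_x`; the content is the converse. Distality
enters only through Ellis' theorem: every orbit closure, for any group of coordinatewise
translations, is minimal (`OrbitClosuresSymm`). This symmetry passes to subgroups and factors.

For second countable `X`, induct on the dimension. Write a `(d+1)`-configuration as `join` of its
two faces. Then `F^[d+1]` consists of the elements `(f, n f)` with `f ∈ F^[d]` and `n` in the group
`N` with `1 × N ⊆ F^[d+1]`. By Baire category and minimality there is a cube `e` over `x` such that
every cube `(e, b)` has `b` in the `N`-orbit closure of `e` (`exists_regular_cube`). Given a cube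
`c` over `x`, its lower face and `e` both lie in `Y_x` by induction, so by symmetry the orbit
closure of `c` contains some `(e, b)`. Regularity puts `(e, b)` in the orbit closure of `(e, e)`,
which lies in that of the constant configuration. Symmetry leads back from `(e, b)` to `c`.

In general, `c` and a basic neighbourhood of it are captured by a countable subgroup `G₀` and a
countable system of functions. These define a second countable minimal `G₀`-factor, where the first
case applies (`cubesAt_subset_faceOrbitClosure`). -/

instance Config.continuousConstSMul {G X : Type*} [Group G] [TopologicalSpace X] [MulAction G X]
    [ContinuousConstSMul G X] (d : ℕ) : ContinuousConstSMul (Config d G) (Config d X) :=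
  ⟨fun γ => continuous_pi fun ω => (continuous_apply ω).const_smul (γ ω)⟩

instance Config.subgroupMulAction {G X : Type*} [Group G] [MulAction G X] {d : ℕ}
    (Γ : Subgroup (Config d G)) : MulAction Γ (Config d X) :=
  Subgroup.instMulAction

instance Config.subgroupSMul {G X : Type*} [Group G] [MulAction G X] {d : ℕ}
    (Γ : Subgroup (Config d G)) : SMul Γ (Config d X) :=
  (Config.subgroupMulAction Γ).toSMul

variable {M Z : Type*} [Group M] [TopologicalSpace Z] [MulAction M Z]

omit [TopologicalSpace Z] in
theorem smul_mem_orbit_subgroup {Γ : Subgroup M} {γ : M} (hγ : γ ∈ Γ) (a : Z) :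
    γ • a ∈ MulAction.orbit Γ a := ⟨⟨γ, hγ⟩, rfl⟩

theorem smul_mem_closure_orbit [ContinuousConstSMul M Z] {Γ : Subgroup M} {a b : Z} {γ : M} (hγ : γ ∈ Γ)
    (hb : b ∈ closure (MulAction.orbit Γ a)) : γ • b ∈ closure (MulAction.orbit Γ a) := by
  refine map_mem_closure (continuous_const_smul γ) hb ?_
  rintro _ ⟨δ, rfl⟩
  exact ⟨⟨γ, hγ⟩ * δ, mul_smul _ _ _⟩

theorem closure_orbit_subset {Γ : Subgroup M} {S : Set Z} (hS : IsClosed S)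
    (hinv : ∀ γ ∈ Γ, ∀ z ∈ S, γ • z ∈ S) {a : Z} (ha : a ∈ S) :
    closure (MulAction.orbit Γ a) ⊆ S := by
  refine closure_minimal ?_ hS
  rintro _ ⟨γ, rfl⟩
  exact hinv γ γ.2 a ha

theorem mem_closure_orbit_trans [ContinuousConstSMul M Z] {Γ : Subgroup M} {a b c : Z}
    (hc : c ∈ closure (MulAction.orbit Γ b)) (hb : b ∈ closure (MulAction.orbit Γ a)) :
    c ∈ closure (MulAction.orbit Γ a) :=
  closure_orbit_subset isClosed_closure (fun _ hγ _ hz => smul_mem_closure_orbit hγ hz) hb hc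

/-- The orbit closures of every group of coordinatewise translations of every `X^[d]` are
pairwise equal or disjoint. -/
def OrbitClosuresSymm (G X : Type*) [Group G] [TopologicalSpace X] [MulAction G X] : Prop :=
  ∀ (d : ℕ) (Γ : Subgroup (Config d G)) (a b : Config d X),
    b ∈ closure (MulAction.orbit Γ a) → a ∈ closure (MulAction.orbit Γ b)

end OrbitClosures

/-! ### Generic continuity of orbit closure maps -/

section Baire

/-- A lower semicontinuous set-valued map on a compact second countable space has a point of
continuity; here the map is `e ↦ closure {T i e | i}`. -/
theorem exists_mem_closure_range_of_mem_closure_graph {ι Y : Type*} [TopologicalSpace Y]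
    [CompactSpace Y] [T2Space Y] [SecondCountableTopology Y] (T : ι → Y → Y)
    (hT : ∀ i, Continuous (T i)) {Z : Set Y} (hZ : IsClosed Z) (hne : Z.Nonempty) :
    ∃ e ∈ Z, ∀ b, (e, b) ∈ closure {p : Y × Y | p.1 ∈ Z ∧ ∃ i, p.2 = T i p.1} →
      b ∈ closure (Set.range fun i => T i e) := by
  have : CompactSpace Z := isCompact_iff_compactSpace.mp hZ.isCompact
  have : Nonempty Z := hne.to_subtype
  let B := TopologicalSpace.countableBasis Y
  have hB := TopologicalSpace.isBasis_countableBasis Y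
  have : Countable B := (TopologicalSpace.countable_countableBasis Y).to_subtype
  let V : B → Set Z := fun U => ⋃ i, {e : Z | T i e ∈ U.1}
  have hV : ∀ U, IsOpen (V U) := fun U => isOpen_iUnion fun i =>
    (hB.isOpen U.2).preimage ((hT i).comp continuous_subtype_val)
  -- The boundary of an open set is nowhere dense, so by Baire some `e` avoids the boundaries of all
  -- the countably many `V U`.
  have hd : Dense (⋂ U, (frontier (V U))ᶜ) := by
    refine dense_iInter_of_isOpen (fun U => isClosed_frontier.isOpen_compl) fun U => ?_
    rw [← interior_eq_empty_iff_dense_compl, ← frontier_compl]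
    exact interior_frontier (hV U).isClosed_compl
  obtain ⟨e, he⟩ := hd.nonempty
  refine ⟨e, e.2, fun b hb => ?_⟩
  rw [hB.mem_closure_iff]
  intro U hU hbU
  have hcl : e ∈ closure (V ⟨U, hU⟩) := by
    rw [closure_subtype, mem_closure_iff_nhds]
    intro W hW
    have hWU : W ×ˢ U ∈ 𝓝 ((e : Y), b) := prod_mem_nhds hW ((hB.isOpen hU).mem_nhds hbU)
    obtain ⟨⟨p, q⟩, ⟨hpW, hqU⟩, hp, i, hq⟩ := mem_closure_iff_nhds.mp hb _ hWU
    obtain rfl : q = T i p := hq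
    exact ⟨p, hpW, ⟨p, hp⟩, Set.mem_iUnion.mpr ⟨i, hqU⟩, rfl⟩
  have hmem : e ∈ V ⟨U, hU⟩ := by
    by_contra hn
    refine Set.mem_iInter.mp he ⟨U, hU⟩ ?_
    rw [frontier, (hV _).interior_eq]
    exact ⟨hcl, hn⟩
  obtain ⟨i, hi⟩ := Set.mem_iUnion.mp hmem
  exact ⟨T i e, hi, i, rfl⟩

end Baire

/-! ### Face group, diagonal and Host–Kra group -/

section CubeGroups

variable {G : Type*} [Group G]

theorem faceElement_mem_faceGroup {d : ℕ} (g : G) (i : Fin d) :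
    faceElement g (hyperface i 1) ∈ faceGroup G d :=
  Subgroup.subset_closure ⟨g, i, rfl⟩

theorem faceGroup_le_hostKraGroup (d : ℕ) : faceGroup G d ≤ hostKraGroup G d :=
  Subgroup.closure_mono fun _ ⟨g, i, h⟩ => ⟨g, i, 1, h⟩

theorem apply_zero_of_mem_faceGroup {d : ℕ} {f : Config d G} (hf : f ∈ faceGroup G d) :
    f 0 = 1 := by
  have : faceGroup G d ≤ (Pi.evalMonoidHom (fun _ : Cube d => G) 0).ker := by
    refine (Subgroup.closure_le _).mpr ?_
    rintro _ ⟨g, i, rfl⟩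
    simp [MonoidHom.mem_ker, faceElement, hyperface]
  exact this hf

theorem conj_constConfig_mem_faceGroup {d : ℕ} (g : G) {f : Config d G}
    (hf : f ∈ faceGroup G d) :
    constConfig d g * f * (constConfig d g)⁻¹ ∈ faceGroup G d := by
  have : faceGroup G d ≤ (faceGroup G d).comap (MulAut.conj (constConfig d g)).toMonoidHom := by
    refine (Subgroup.closure_le _).mpr ?_
    rintro _ ⟨h, i, rfl⟩
    have : constConfig d g * faceElement h (hyperface i 1) * (constConfig d g)⁻¹ =
        faceElement (g * h * g⁻¹) (hyperface i 1) := by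
      ext ω; by_cases hω : ω ∈ hyperface i 1 <;> simp [faceElement, hω, constConfig]
    simpa [this] using faceElement_mem_faceGroup (g * h * g⁻¹) i
  exact this hf

/-- The group `F^[d] ⬝ Δ` generated by the upper hyperfaces and the diagonal. It equals `HK^[d]`
for `d ≥ 1`. -/
def faceDiagGroup (G : Type*) [Group G] (d : ℕ) : Subgroup (Config d G) where
  carrier := {γ | ∃ f ∈ faceGroup G d, ∃ g : G, γ = f * constConfig d g}
  one_mem' := ⟨1, one_mem _, 1, by ext; simp [constConfig]⟩
  mul_mem' := by
    rintro _ _ ⟨f, hf, g, rfl⟩ ⟨f', hf', g', rfl⟩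
    refine ⟨_, mul_mem hf (conj_constConfig_mem_faceGroup g hf'), g * g', ?_⟩
    ext; simp [constConfig, mul_assoc]
  inv_mem' := by
    rintro _ ⟨f, hf, g, rfl⟩
    refine ⟨_, conj_constConfig_mem_faceGroup g⁻¹ (inv_mem hf), g⁻¹, ?_⟩
    ext; simp [constConfig, mul_assoc]

theorem constConfig_mem_faceDiagGroup (d : ℕ) (g : G) : constConfig d g ∈ faceDiagGroup G d :=
  ⟨1, one_mem _, g, by simp⟩

theorem faceGroup_le_faceDiagGroup (d : ℕ) : faceGroup G d ≤ faceDiagGroup G d :=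
  fun f hf => ⟨f, hf, 1, by ext; simp [constConfig]⟩

theorem hostKraGroup_le_faceDiagGroup (d : ℕ) : hostKraGroup G d ≤ faceDiagGroup G d := by
  refine (Subgroup.closure_le _).mpr ?_
  rintro _ ⟨g, i, a, rfl⟩
  obtain rfl | rfl : a = 0 ∨ a = 1 := by omega
  -- A lower hyperface element is the diagonal element `g` corrected by `g⁻¹` on the opposite upper
  -- hyperface.
  · refine ⟨_, faceElement_mem_faceGroup g⁻¹ i, g, ?_⟩
    ext ω
    by_cases hω : ω i = 0
    · simp [faceElement, hyperface, constConfig, hω]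
    · have : ω i = 1 := by omega
      simp [faceElement, hyperface, constConfig, this]
  · exact faceGroup_le_faceDiagGroup d (faceElement_mem_faceGroup g i)

end CubeGroups

/-! ### The cube as two parallel faces; semidirect structure of the face group -/

section Splitting

variable {G X : Type*} [Group G] {d : ℕ}

/-- The restriction of a configuration to the face `{ω | ω 0 = a}`. -/
def faceRestrict (a : Fin 2) (c : Config (d + 1) X) : Config d X :=
  fun ω => c (Fin.cons a ω)

/-- The configuration with prescribed restrictions to `{ω | ω 0 = 0}` and `{ω | ω 0 = 1}`. -/
def join (a b : Config d X) : Config (d + 1) X :=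
  fun ω => if ω 0 = 0 then a (Fin.tail ω) else b (Fin.tail ω)

@[simp] theorem faceRestrict_zero_join (a b : Config d X) : faceRestrict 0 (join a b) = a := by
  ext ω; simp [faceRestrict, join]

@[simp] theorem faceRestrict_one_join (a b : Config d X) : faceRestrict 1 (join a b) = b := by
  ext ω; simp [faceRestrict, join]

theorem join_faceRestrict (c : Config (d + 1) X) :
    join (faceRestrict 0 c) (faceRestrict 1 c) = c := by
  ext ω
  have h := Fin.cons_self_tail ω
  by_cases hω : ω 0 = 0
  · rw [hω] at h
    simp [faceRestrict, join, hω, h]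
  · have h1 : ω 0 = 1 := by omega
    rw [h1] at h
    simp [faceRestrict, join, h1, h]

theorem join_constConfig (x : X) :
    join (constConfig d x) (constConfig d x) = constConfig (d + 1) x := by
  ext ω; simp [join, constConfig]

theorem join_smul_join [MulAction G X] (a b : Config d G) (u v : Config d X) :
    join a b • join u v = join (a • u) (b • v) := by
  ext ω
  by_cases hω : ω 0 = 0 <;> simp [join, hω]

theorem join_mul_join (a b a' b' : Config d G) :
    join a b * join a' b' = join (a * a') (b * b') :=
  join_smul_join a b a' b'

theorem join_inv (a b : Config d G) : (join a b)⁻¹ = join a⁻¹ b⁻¹ := by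
  ext ω
  by_cases hω : ω 0 = 0 <;> simp [join, hω]

theorem join_one_one : join (1 : Config d G) 1 = 1 := join_constConfig 1

theorem join_const_faceElement (g : G) :
    join 1 (constConfig d g) = faceElement g (hyperface 0 1) := by
  ext ω
  by_cases hω : ω 0 = 0
  · simp [join, faceElement, hyperface, hω]
  · have h1 : ω 0 = 1 := by omega
    simp [join, faceElement, hyperface, h1, constConfig]

theorem join_faceElement_faceElement (g : G) (i : Fin d) :
    join (faceElement g (hyperface i 1)) (faceElement g (hyperface i 1)) =
      faceElement g (hyperface i.succ 1) := by
  ext ω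
  by_cases hω : ω i.succ = 1 <;> simp [join, faceElement, hyperface, Fin.tail, hω]

theorem join_self_mem_faceGroup {f : Config d G} (hf : f ∈ faceGroup G d) :
    join f f ∈ faceGroup G (d + 1) := by
  let φ : Config d G →* Config (d + 1) G :=
    { toFun := fun f => join f f
      map_one' := join_one_one
      map_mul' := fun a b => (join_mul_join a a b b).symm }
  have : faceGroup G d ≤ (faceGroup G (d + 1)).comap φ := by
    refine (Subgroup.closure_le _).mpr ?_
    rintro _ ⟨g, i, rfl⟩
    change join _ _ ∈ faceGroup G (d + 1)
    rw [join_faceElement_faceElement]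
    exact faceElement_mem_faceGroup g _
  exact this hf

theorem join_one_constConfig_mem_faceGroup (g : G) :
    join 1 (constConfig d g) ∈ faceGroup G (d + 1) := by
  rw [join_const_faceElement]
  exact faceElement_mem_faceGroup g 0

/-- The group of all `n` such that `(1, n)` is in the face group. -/
def upperGroup (G : Type*) [Group G] (d : ℕ) : Subgroup (Config d G) :=
  (faceGroup G (d + 1)).comap
    { toFun := fun n => join 1 n
      map_one' := join_one_one
      map_mul' := fun a b => by rw [join_mul_join, one_mul] }

theorem mem_upperGroup {n : Config d G} : n ∈ upperGroup G d ↔ join 1 n ∈ faceGroup G (d + 1) :=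
  Iff.rfl

theorem constConfig_mem_upperGroup (g : G) : constConfig d g ∈ upperGroup G d :=
  join_one_constConfig_mem_faceGroup g

theorem conj_mem_upperGroup {f n : Config d G} (hf : f ∈ faceGroup G d)
    (hn : n ∈ upperGroup G d) : f * n * f⁻¹ ∈ upperGroup G d := by
  have := mul_mem (mul_mem (join_self_mem_faceGroup hf) (mem_upperGroup.mp hn)) (inv_mem (join_self_mem_faceGroup hf))
  simpa [join_mul_join, join_inv, mem_upperGroup] using this

/-- The generators in direction `0` are `(1, g)` with `g` constant; the others are doubled
generators `(f, f)`. Since the doubled group normalises `1 × N`, the products form a group. -/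
theorem exists_join_of_mem_faceGroup {γ : Config (d + 1) G} (hγ : γ ∈ faceGroup G (d + 1)) :
    ∃ f ∈ faceGroup G d, ∃ n ∈ upperGroup G d, γ = join f (n * f) := by
  let S : Subgroup (Config (d + 1) G) :=
    { carrier := {γ | ∃ f ∈ faceGroup G d, ∃ n ∈ upperGroup G d, γ = join f (n * f)}
      one_mem' := ⟨1, one_mem _, 1, one_mem _, by simp [join_one_one]⟩
      mul_mem' := by
        rintro _ _ ⟨f, hf, n, hn, rfl⟩ ⟨f', hf', n', hn', rfl⟩
        refine ⟨_, mul_mem hf hf', _, mul_mem hn (conj_mem_upperGroup hf hn'), ?_⟩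
        simp [join_mul_join, mul_assoc]
      inv_mem' := by
        rintro _ ⟨f, hf, n, hn, rfl⟩
        refine ⟨_, inv_mem hf, _, conj_mem_upperGroup (inv_mem hf) (inv_mem hn), ?_⟩
        simp [join_inv, mul_assoc] }
  have : faceGroup G (d + 1) ≤ S := by
    refine (Subgroup.closure_le _).mpr ?_
    rintro _ ⟨g, i, rfl⟩
    cases i using Fin.cases with
    | zero =>
      refine ⟨1, one_mem _, _, constConfig_mem_upperGroup g, ?_⟩
      simp [join_const_faceElement]
    | succ i =>
      refine ⟨_, faceElement_mem_faceGroup g i, 1, one_mem _, ?_⟩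
      simp [join_faceElement_faceElement]
  exact this hγ

theorem upperGroup_le_faceDiagGroup : upperGroup G d ≤ faceDiagGroup G d := by
  let φ : Config (d + 1) G →* Config d G :=
    { toFun := faceRestrict 1
      map_one' := rfl
      map_mul' := fun _ _ => rfl }
  have : faceGroup G (d + 1) ≤ (faceDiagGroup G d).comap φ := by
    refine (Subgroup.closure_le _).mpr ?_
    rintro _ ⟨g, i, rfl⟩
    change faceRestrict 1 (faceElement g (hyperface i 1)) ∈ faceDiagGroup G d
    cases i using Fin.cases with
    | zero =>
      rw [← join_const_faceElement, faceRestrict_one_join]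
      exact constConfig_mem_faceDiagGroup d g
    | succ i =>
      rw [← join_faceElement_faceElement, faceRestrict_one_join]
      exact faceGroup_le_faceDiagGroup d (faceElement_mem_faceGroup g i)
  intro n hn
  have h : faceRestrict 1 (join 1 n) ∈ faceDiagGroup G d := this hn
  simpa using h

end Splitting

/-! ### Dynamical cubes and the second countable case -/

section DynamicalCubes

variable {G X : Type*} [Group G] [TopologicalSpace X] [MulAction G X]

omit [TopologicalSpace X] in
theorem constConfig_smul_constConfig {d : ℕ} (g : G) (x : X) :
    constConfig d g • constConfig d x = constConfig d (g • x) := rfl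

/-- The diagonal part of a Host–Kra element is absorbed into the base point. -/
theorem dynCubes_eq_closure_faceGroup (d : ℕ) :
    dynCubes G X d =
      closure {c | ∃ f ∈ faceGroup G d, ∃ y : X, c = f • constConfig d y} := by
  refine congrArg closure (Set.Subset.antisymm ?_ ?_)
  · refine Set.iUnion_subset fun x => ?_
    rintro _ ⟨⟨γ, hγ⟩, rfl⟩
    obtain ⟨f, hf, g, rfl⟩ := hostKraGroup_le_faceDiagGroup d hγ
    exact ⟨f, hf, g • x, mul_smul f (constConfig d g) (constConfig d x)⟩
  · rintro _ ⟨f, hf, y, rfl⟩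
    exact Set.mem_iUnion.mpr ⟨y, ⟨f, faceGroup_le_hostKraGroup d hf⟩, rfl⟩

theorem isClosed_dynCubes (d : ℕ) : IsClosed (dynCubes G X d) := isClosed_closure

theorem constConfig_mem_dynCubes (d : ℕ) (x : X) : constConfig d x ∈ dynCubes G X d := by
  rw [dynCubes_eq_closure_faceGroup]
  exact subset_closure ⟨1, one_mem _, x, (one_smul _ _).symm⟩

theorem continuous_join {d : ℕ} {Y : Type*} [TopologicalSpace Y] {u v : Y → Config d X}
    (hu : Continuous u) (hv : Continuous v) : Continuous fun y => join (u y) (v y) := by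
  refine continuous_pi fun ω => ?_
  by_cases hω : ω 0 = 0
  · simpa [join, hω] using continuous_pi_iff.mp hu (Fin.tail ω)
  · simpa [join, hω] using continuous_pi_iff.mp hv (Fin.tail ω)

theorem continuous_faceRestrict {d : ℕ} (a : Fin 2) :
    Continuous (faceRestrict a : Config (d + 1) X → Config d X) :=
  continuous_pi fun _ => continuous_apply _

variable [ContinuousConstSMul G X]

theorem smul_mem_dynCubes {d : ℕ} {γ : Config d G} (hγ : γ ∈ faceDiagGroup G d)
    {c : Config d X} (hc : c ∈ dynCubes G X d) : γ • c ∈ dynCubes G X d := by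
  rw [dynCubes_eq_closure_faceGroup] at hc ⊢
  refine map_mem_closure (continuous_const_smul γ) hc ?_
  rintro _ ⟨f, hf, y, rfl⟩
  obtain ⟨f', hf', g, h⟩ := mul_mem hγ (faceGroup_le_faceDiagGroup d hf)
  exact ⟨f', hf', g • y, by rw [← mul_smul, h, mul_smul, constConfig_smul_constConfig]⟩

theorem closure_orbit_subset_dynCubes {d : ℕ} {Γ : Subgroup (Config d G)}
    (hΓ : Γ ≤ faceDiagGroup G d) {c : Config d X} (hc : c ∈ dynCubes G X d) :
    closure (MulAction.orbit Γ c) ⊆ dynCubes G X d :=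
  closure_orbit_subset (isClosed_dynCubes d)
    (fun _ hγ _ hz => smul_mem_dynCubes (hΓ hγ) hz) hc

theorem join_self_mem_faceDiagGroup {d : ℕ} {γ : Config d G} (hγ : γ ∈ faceDiagGroup G d) :
    join γ γ ∈ faceDiagGroup G (d + 1) := by
  obtain ⟨f, hf, g, rfl⟩ := hγ
  refine ⟨_, join_self_mem_faceGroup hf, g, ?_⟩
  rw [← join_constConfig, join_mul_join]

/-- `(n, 1) = (n, n) (1, n⁻¹)`. This allows the lower face of a cube to be moved by `N` while the
upper face stays fixed. -/
theorem join_one_right_mem_faceDiagGroup {d : ℕ} {n : Config d G} (hn : n ∈ upperGroup G d) :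
    join n 1 ∈ faceDiagGroup G (d + 1) := by
  have h := mul_mem (join_self_mem_faceDiagGroup (upperGroup_le_faceDiagGroup hn))
    (faceGroup_le_faceDiagGroup _ (mem_upperGroup.mp (inv_mem hn)))
  simpa [join_mul_join] using h

omit [ContinuousConstSMul G X] in
theorem faceRestrict_zero_mem_dynCubes {d : ℕ} {c : Config (d + 1) X}
    (hc : c ∈ dynCubes G X (d + 1)) : faceRestrict 0 c ∈ dynCubes G X d := by
  rw [dynCubes_eq_closure_faceGroup] at hc ⊢
  refine map_mem_closure (continuous_faceRestrict 0) hc ?_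
  rintro _ ⟨γ, hγ, y, rfl⟩
  obtain ⟨f, hf, n, -, rfl⟩ := exists_join_of_mem_faceGroup hγ
  refine ⟨f, hf, y, ?_⟩
  rw [← join_constConfig, join_smul_join, faceRestrict_zero_join]

theorem mem_closure_graph_of_join_mem_dynCubes {d : ℕ} {e b : Config d X}
    (h : join e b ∈ dynCubes G X (d + 1)) :
    (e, b) ∈ closure {p : Config d X × Config d X |
      p.1 ∈ dynCubes G X d ∧ ∃ n : upperGroup G d, p.2 = (n : Config d G) • p.1} := by
  rw [dynCubes_eq_closure_faceGroup] at h
  have := map_mem_closure ((continuous_faceRestrict 0).prodMk (continuous_faceRestrict 1)) h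
    (t := {p : Config d X × Config d X |
      p.1 ∈ dynCubes G X d ∧ ∃ n : upperGroup G d, p.2 = (n : Config d G) • p.1}) ?_
  · simpa using this
  · rintro _ ⟨γ, hγ, y, rfl⟩
    obtain ⟨f, hf, n, hn, rfl⟩ := exists_join_of_mem_faceGroup hγ
    rw [← join_constConfig, join_smul_join]
    simp only [Set.mem_ofPred_eq, faceRestrict_zero_join, faceRestrict_one_join]
    exact ⟨smul_mem_dynCubes (faceGroup_le_faceDiagGroup d hf) (constConfig_mem_dynCubes d y),
      ⟨n, hn⟩, mul_smul _ _ _⟩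

variable [CompactSpace X] [T2Space X]

-- `N` contains the diagonal, so the `0`-coordinates of the orbit fill a dense `G`-orbit;
-- compactness makes their closure attained.
omit [ContinuousConstSMul G X] in
theorem exists_zero_eq_mem_closure_orbit_upperGroup [MulAction.IsMinimal G X] {d : ℕ} (x : X)
    (e : Config d X) : ∃ e' ∈ closure (MulAction.orbit (upperGroup G d) e), e' 0 = x := by
  have hc : IsClosed ((fun c : Config d X => c 0) '' closure (MulAction.orbit (upperGroup G d) e)) :=
    (isClosed_closure.isCompact.image (continuous_apply 0)).isClosed
  have hsub : MulAction.orbit G (e 0) ⊆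
      (fun c : Config d X => c 0) '' closure (MulAction.orbit (upperGroup G d) e) := by
    rintro _ ⟨g, rfl⟩
    exact ⟨constConfig d g • e,
      subset_closure (smul_mem_orbit_subgroup (constConfig_mem_upperGroup g) e), rfl⟩
  have := closure_minimal hsub hc
  rw [(MulAction.IsMinimal.dense_orbit (M := G) (e 0)).closure_eq] at this
  exact this (Set.mem_univ x)

/-- Over every point there is a cube `e` such that the only cubes with lower face `e` are those
given by the orbit closure of `e` under the group of upper faces. -/
theorem exists_regular_cube [SecondCountableTopology X] [MulAction.IsMinimal G X]
    (hsym : OrbitClosuresSymm G X) (d : ℕ) (x : X) :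
    ∃ e ∈ cubesAt G d x, ∀ b, join e b ∈ dynCubes G X (d + 1) →
      b ∈ closure (MulAction.orbit (upperGroup G d) e) := by
  obtain ⟨e₀, he₀, hreg⟩ := exists_mem_closure_range_of_mem_closure_graph
    (fun (n : upperGroup G d) (c : Config d X) => (n : Config d G) • c)
    (fun n => continuous_const_smul (n : Config d G)) (isClosed_dynCubes (G := G) d)
    ⟨_, constConfig_mem_dynCubes d x⟩
  obtain ⟨e, he, hx⟩ := exists_zero_eq_mem_closure_orbit_upperGroup (G := G) x e₀
  refine ⟨e, ⟨closure_orbit_subset_dynCubes upperGroup_le_faceDiagGroup he₀ he, hx⟩, fun b hb => ?_⟩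
  have hsymm := hsym d _ _ _ he
  -- Regularity is known at `e₀` only. The set of `z` with `(z, b)` a cube is closed and
  -- `N`-invariant, so it contains `e₀` along with `e`.
  have hjoin : join e₀ b ∈ dynCubes G X (d + 1) := by
    have : ∀ z ∈ closure (MulAction.orbit (upperGroup G d) e), join z b ∈ dynCubes G X (d + 1) := by
      refine closure_orbit_subset (S := {z | join z b ∈ dynCubes G X (d + 1)})
        ((isClosed_dynCubes _).preimage (continuous_join continuous_id continuous_const)) ?_ hb
      intro n hn z hz
      have := smul_mem_dynCubes (join_one_right_mem_faceDiagGroup hn) hz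
      rwa [join_smul_join, one_smul] at this
    exact this _ hsymm
  exact mem_closure_orbit_trans (hreg b (mem_closure_graph_of_join_mem_dynCubes hjoin)) hsymm

-- The doubled elements `(f, f)` lift the motion of the lower face; compactness lifts its limits.
omit [ContinuousConstSMul G X] in
theorem exists_join_mem_closure_orbit {d : ℕ} {c : Config (d + 1) X} {e : Config d X}
    (he : e ∈ closure (MulAction.orbit (faceGroup G d) (faceRestrict 0 c))) :
    ∃ b, join e b ∈ closure (MulAction.orbit (faceGroup G (d + 1)) c) := by
  have hc : IsClosed (faceRestrict 0 '' closure (MulAction.orbit (faceGroup G (d + 1)) c)) :=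
    (isClosed_closure.isCompact.image (continuous_faceRestrict 0)).isClosed
  have hsub : MulAction.orbit (faceGroup G d) (faceRestrict 0 c) ⊆
      faceRestrict 0 '' closure (MulAction.orbit (faceGroup G (d + 1)) c) := by
    rintro _ ⟨⟨f, hf⟩, rfl⟩
    refine ⟨join f f • c, subset_closure
      (smul_mem_orbit_subgroup (join_self_mem_faceGroup hf) c), ?_⟩
    conv_lhs => rw [← join_faceRestrict c, join_smul_join, faceRestrict_zero_join]
    rfl
  obtain ⟨z, hz, rfl⟩ := closure_minimal hsub hc he
  exact ⟨faceRestrict 1 z, by rwa [join_faceRestrict]⟩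

omit [ContinuousConstSMul G X] [CompactSpace X] [T2Space X] in
theorem join_self_mem_closure_orbit {d : ℕ} {x : X} {e : Config d X}
    (he : e ∈ faceOrbitClosure G d x) : join e e ∈ faceOrbitClosure G (d + 1) x := by
  refine map_mem_closure (f := fun e : Config d X => join e e)
    (continuous_join continuous_id continuous_id) he ?_
  rintro _ ⟨⟨f, hf⟩, rfl⟩
  refine ⟨⟨join f f, join_self_mem_faceGroup hf⟩, ?_⟩
  change join f f • constConfig (d + 1) x = join (f • constConfig d x) (f • constConfig d x)
  rw [← join_constConfig, join_smul_join]

omit [ContinuousConstSMul G X] [CompactSpace X] [T2Space X] in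
theorem join_mem_closure_orbit_join_self {d : ℕ} {e b : Config d X}
    (hb : b ∈ closure (MulAction.orbit (upperGroup G d) e)) :
    join e b ∈ closure (MulAction.orbit (faceGroup G (d + 1)) (join e e)) := by
  refine map_mem_closure (continuous_join continuous_const continuous_id) hb ?_
  rintro _ ⟨⟨n, hn⟩, rfl⟩
  refine ⟨⟨join 1 n, hn⟩, ?_⟩
  change join 1 n • join e e = join e (n • e)
  rw [join_smul_join, one_smul]

theorem cubesAt_subset_faceOrbitClosure_of_secondCountable [SecondCountableTopology X]
    [MulAction.IsMinimal G X] (hsym : OrbitClosuresSymm G X) (d : ℕ) (x : X) :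
    cubesAt G d x ⊆ faceOrbitClosure G d x := by
  induction d with
  | zero =>
    rintro c ⟨-, hc⟩
    have : c = constConfig 0 x := by
      ext ω
      rw [Subsingleton.elim ω 0]
      exact hc
    rw [this]
    exact subset_closure (MulAction.mem_orbit_self _)
  | succ d ih =>
    rintro c ⟨hc, hcx⟩
    have hc₀ : faceRestrict 0 c ∈ faceOrbitClosure G d x := by
      refine ih ⟨faceRestrict_zero_mem_dynCubes hc, ?_⟩
      change c (Fin.cons 0 0) = x
      rw [← hcx]
      congr 1
      ext i
      cases i using Fin.cases <;> rfl
    obtain ⟨e, he, hreg⟩ := exists_regular_cube hsym d x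
    have hex := ih he
    obtain ⟨b, hb⟩ := exists_join_mem_closure_orbit
      (mem_closure_orbit_trans hex (hsym d _ _ _ hc₀))
    have hb' := hreg b (closure_orbit_subset_dynCubes (faceGroup_le_faceDiagGroup _) hc hb)
    exact mem_closure_orbit_trans (hsym _ _ _ _ hb)
      (mem_closure_orbit_trans (join_mem_closure_orbit_join_self hb')
        (join_self_mem_closure_orbit hex))

omit [CompactSpace X] in
theorem faceOrbitClosure_subset_cubesAt (d : ℕ) (x : X) :
    faceOrbitClosure G d x ⊆ cubesAt G d x := by
  intro c hc
  refine ⟨closure_orbit_subset_dynCubes (faceGroup_le_faceDiagGroup d)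
    (constConfig_mem_dynCubes d x) hc, ?_⟩
  refine closure_orbit_subset (S := {c : Config d X | c 0 = x})
    (isClosed_eq (continuous_apply 0) continuous_const) ?_ rfl hc
  intro f hf z hz
  change f 0 • z 0 = x
  rw [apply_zero_of_mem_faceGroup hf, one_smul]
  exact hz

end DynamicalCubes

/-! ### Distality and the Ellis semigroup -/

section EllisSemigroup

/-- Ellis' argument: idempotents of the enveloping semigroup `closure R` act as the identity, which
gives its elements left inverses. -/
theorem mem_closure_orbit_symm_of_proximal_eq {M Z : Type*} [Group M] [TopologicalSpace Z]
    [CompactSpace Z] [T2Space Z] [MulAction M Z] [ContinuousConstSMul M Z] (Γ : Subgroup M)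
    (hprox : ∀ a b c : Z,
      (c, c) ∈ closure (Set.range fun γ : Γ => ((γ : M) • a, (γ : M) • b)) → a = b)
    {a b : Z} (hb : b ∈ closure (MulAction.orbit Γ a)) : a ∈ closure (MulAction.orbit Γ b) := by
  let _ : TopologicalSpace (Function.End Z) := Pi.topologicalSpace
  have : T2Space (Function.End Z) := inferInstanceAs (T2Space (Z → Z))
  have : CompactSpace (Function.End Z) := inferInstanceAs (CompactSpace (Z → Z))
  have heval : ∀ z : Z, Continuous fun p : Function.End Z => p z := fun z => continuous_apply z
  have hmulR : ∀ q : Function.End Z, Continuous fun p : Function.End Z => p * q :=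
    fun q => continuous_pi fun z => heval (q z)
  let R : Set (Function.End Z) := Set.range fun (γ : Γ) (z : Z) => (γ : M) • z
  have hcomp : ∀ p ∈ closure R, ∀ q ∈ closure R, p * q ∈ closure R := by
    intro p hp q hq
    have h : ∀ p ∈ R, p * q ∈ closure R := by
      rintro _ ⟨γ, rfl⟩
      refine map_mem_closure (f := fun q : Function.End Z =>
        (show Function.End Z from fun z => (γ : M) • z) * q)
        (continuous_pi fun z => (heval z).const_smul (γ : M)) hq ?_
      rintro _ ⟨δ, rfl⟩
      exact ⟨γ * δ, funext fun z => mul_smul (γ : M) (δ : M) z⟩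
    have := map_mem_closure (hmulR q) hp h
    rwa [closure_closure] at this
  -- An idempotent `u` sends both `z` and `u z` to `u z`, so the two points are proximal.
  have hidem : ∀ u ∈ closure R, u * u = u → ∀ z, u z = z := by
    intro u hu huu z
    refine (hprox z (u z) (u z) ?_).symm
    have h := map_mem_closure ((heval z).prodMk (heval (u z))) hu
      (t := Set.range fun γ : Γ => ((γ : M) • z, (γ : M) • u z)) ?_
    · rwa [show u (u z) = u z from congrFun huu z] at h
    · rintro _ ⟨γ, rfl⟩
      exact ⟨γ, rfl⟩
  obtain ⟨p, hp, rfl⟩ : ∃ p ∈ closure R, p a = b := by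
    have hcl : IsClosed ((fun p : Function.End Z => p a) '' closure R) :=
      (isClosed_closure.isCompact.image (heval a)).isClosed
    refine closure_minimal ?_ hcl hb
    rintro _ ⟨γ, rfl⟩
    exact ⟨_, subset_closure ⟨γ, rfl⟩, rfl⟩
  -- The left ideal `closure R * p` is a compact semigroup; its idempotent `q * p` is the identity,
  -- so `q` carries `b = p a` back to `a`.
  obtain ⟨_, ⟨q, hq, rfl⟩, hqp⟩ := exists_idempotent_in_compact_subsemigroup hmulR
    ((fun q => q * p) '' closure R) (Set.Nonempty.image _ ⟨p, hp⟩)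
    (isClosed_closure.isCompact.image (hmulR p)) (by
      rintro _ ⟨q, hq, rfl⟩ _ ⟨q', hq', rfl⟩
      exact ⟨q * p * q', hcomp _ (hcomp _ hq _ hp) _ hq', mul_assoc _ _ _⟩)
  have ha : q (p a) = a := hidem _ (hcomp _ hq _ hp) hqp a
  have := map_mem_closure (heval (p a)) hq (t := MulAction.orbit Γ (p a)) (by
    rintro _ ⟨γ, rfl⟩
    exact ⟨γ, rfl⟩)
  rwa [ha] at this

theorem OrbitClosuresSymm.of_isDistal {G X : Type*} [Group G] [TopologicalSpace X]
    [CompactSpace X] [T2Space X] [MulAction G X] [ContinuousConstSMul G X]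
    (h : IsDistal G X) : OrbitClosuresSymm G X := by
  intro d Γ a b hb
  refine mem_closure_orbit_symm_of_proximal_eq Γ (fun u v c hc => funext fun ω => ?_) hb
  have hp : (u ω, v ω) ∈ {p : X × X | Proximal G p.1 p.2} := by
    intro U hU
    have hmem := map_mem_closure (f := fun p : Config d X × Config d X => (p.1 ω, p.2 ω))
      (by fun_prop) hc (t := Set.range fun g : G => (g • u ω, g • v ω)) (by
        rintro _ ⟨γ, rfl⟩
        exact ⟨(γ : Config d G) ω, rfl⟩)
    obtain ⟨_, hU', g, rfl⟩ := mem_closure_iff_nhds.mp hmem U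
      (nhds_le_nhdsSet (Set.mem_diagonal (c ω)) hU)
    exact ⟨g, hU'⟩
  rw [h] at hp
  exact hp

/-- Lift `a₀` arbitrarily to `a`, and lift `b₀` into the orbit closure of `a` by compactness;
symmetry upstairs then projects down. -/
theorem OrbitClosuresSymm.of_factor {G X X₀ : Type*} [Group G] [TopologicalSpace X]
    [CompactSpace X] [MulAction G X] [TopologicalSpace X₀] [T2Space X₀] {G₀ : Subgroup G}
    [MulAction G₀ X₀] (h : OrbitClosuresSymm G X) {π : X → X₀} (hπ : Continuous π)
    (hsurj : Function.Surjective π) (hequiv : ∀ (g : G₀) x, π ((g : G) • x) = g • π x) :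
    OrbitClosuresSymm G₀ X₀ := by
  intro d Γ₀ a₀ b₀ hb
  let φ : Config d G₀ →* Config d G := G₀.subtype.compLeft (Cube d)
  let P : Config d X → Config d X₀ := fun c ω => π (c ω)
  have hP : Continuous P := by fun_prop
  have hmaps : ∀ c, Set.MapsTo P (MulAction.orbit (Γ₀.map φ) c) (MulAction.orbit Γ₀ (P c)) := by
    rintro c _ ⟨⟨_, γ, hγ, rfl⟩, rfl⟩
    exact ⟨⟨γ, hγ⟩, funext fun ω => (hequiv (γ ω) (c ω)).symm⟩
  obtain ⟨a, rfl⟩ : ∃ a, P a = a₀ :=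
    ⟨fun ω => (hsurj (a₀ ω)).choose, funext fun ω => (hsurj (a₀ ω)).choose_spec⟩
  obtain ⟨b, hb', rfl⟩ : b₀ ∈ P '' closure (MulAction.orbit (Γ₀.map φ) a) := by
    refine closure_minimal ?_ (isClosed_closure.isCompact.image hP).isClosed hb
    rintro _ ⟨⟨γ, hγ⟩, rfl⟩
    exact ⟨φ γ • a, subset_closure (smul_mem_orbit_subgroup (Subgroup.mem_map_of_mem φ hγ) a),
      funext fun ω => hequiv (γ ω) (a ω)⟩
  exact map_mem_closure hP (h d _ _ _ hb') (hmaps b)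

end EllisSemigroup

/-! ### Countable closure under finitary operations -/

section CountableHull

/-- Every countable set is contained in a countable set which is closed under a given operation of
finite arity with countably many values. -/
theorem exists_countable_superset_closed {κ M : Type*} [Finite κ] (w : (κ → M) → Set M)
    (hw : ∀ φ, (w φ).Countable) {S₀ : Set M} (hS₀ : S₀.Countable) :
    ∃ S, S₀ ⊆ S ∧ S.Countable ∧ ∀ φ : κ → M, (∀ i, φ i ∈ S) → w φ ⊆ S := by
  let step : Set M → Set M := fun S => S ∪ ⋃ φ : κ → S, w fun i => φ i
  let T : ℕ → Set M := fun n => step^[n] S₀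
  have hsucc : ∀ n, T (n + 1) = step (T n) := fun n => Function.iterate_succ_apply' step n S₀
  have hmono : Monotone T := monotone_nat_of_le_succ fun n => by
    rw [hsucc]; exact Set.subset_union_left
  have hcount : ∀ n, (T n).Countable := by
    intro n
    induction n with
    | zero => exact hS₀
    | succ n ih =>
      rw [hsucc]
      have : Countable (T n) := ih.to_subtype
      exact ih.union (Set.countable_iUnion fun φ => hw _)
  refine ⟨⋃ n, T n, Set.subset_iUnion T 0, Set.countable_iUnion hcount, fun φ hφ => ?_⟩
  -- Finite arity makes all arguments appear at one common stage.
  choose N hN using fun i => Set.mem_iUnion.mp (hφ i)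
  obtain ⟨m, hm⟩ := (Set.finite_range N).bddAbove
  have hφm : ∀ i, φ i ∈ T m := fun i => hmono (hm ⟨i, rfl⟩) (hN i)
  refine Set.Subset.trans ?_ (Set.subset_iUnion T (m + 1))
  rw [hsucc]
  exact Set.Subset.trans
    (Set.subset_iUnion (fun φ : κ → T m => w fun i => φ i) fun i => ⟨φ i, hφm i⟩)
    Set.subset_union_right

end CountableHull

/-! ### Second countable factors from countable function systems -/

section FunctionQuotient

universe u

variable {G : Type*} {X : Type u} [Group G] [TopologicalSpace X] [MulAction G X]

/-- The translate `x ↦ f (g x)` of a continuous function. -/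
def translate [ContinuousConstSMul G X] (g : G) (f : C(X, ℝ)) : C(X, ℝ) :=
  f.comp ⟨fun x => g • x, continuous_const_smul g⟩

/-- A system of continuous functions is `Saturated` for a group of homeomorphisms if it is closed
under translation, products and rational truncation. -/
structure Saturated [ContinuousConstSMul G X] (G₀ : Subgroup G) (A : Set C(X, ℝ)) : Prop where
  one_mem : 1 ∈ A
  mul_mem : ∀ f ∈ A, ∀ f' ∈ A, f * f' ∈ A
  sub_sup_mem : ∀ f ∈ A, ∀ r : ℚ, (f - ContinuousMap.const X (r : ℝ)) ⊔ 0 ∈ A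
  const_sub_sup_mem : ∀ f ∈ A, ∀ r : ℚ, (ContinuousMap.const X (r : ℝ) - f) ⊔ 0 ∈ A
  translate_mem : ∀ g ∈ G₀, ∀ f ∈ A, translate g f ∈ A

/-- The equivalence relation of not being separated by the functions in `A`. -/
def functionSetoid (A : Set C(X, ℝ)) : Setoid X where
  r x y := ∀ f ∈ A, f x = f y
  iseqv := ⟨fun _ _ _ => rfl, fun h f hf => (h f hf).symm,
    fun h h' f hf => (h f hf).trans (h' f hf)⟩

variable [ContinuousConstSMul G X] {G₀ : Subgroup G} {A : Set C(X, ℝ)}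

/-- Truncating at a rational strictly between `f p` and `f q` kills the function near `q` but not at
`p`. -/
theorem Saturated.exists_ne_zero_eventually_eq_zero (hA : Saturated G₀ A) {p q : X}
    {f : C(X, ℝ)} (hf : f ∈ A) (hpq : f p ≠ f q) :
    ∃ h ∈ A, h p ≠ 0 ∧ ∀ᶠ x in 𝓝 q, h x = 0 := by
  rcases lt_or_gt_of_ne hpq with hlt | hlt
  · obtain ⟨r, hpr, hrq⟩ := exists_rat_btwn hlt
    refine ⟨_, hA.const_sub_sup_mem f hf r, ?_, ?_⟩
    · simpa using hpr
    · filter_upwards [f.continuous.continuousAt.eventually_const_lt hrq] with x hx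
      simpa using hx.le
  · obtain ⟨r, hqr, hrp⟩ := exists_rat_btwn hlt
    refine ⟨_, hA.sub_sup_mem f hf r, ?_, ?_⟩
    · simpa using hrp
    · filter_upwards [f.continuous.continuousAt.eventually_lt_const hqr] with x hx
      simpa using hx.le

/-- Compactness reduces this to finitely many neighbourhoods, and the product of their functions
works. The nonvanishing sets of `A` thereby give a basis of the quotient topology. -/
theorem Saturated.exists_ne_zero_eq_zero_on (hA : Saturated G₀ A) {p : X} {K : Set X}
    (hK : IsCompact K) (hp : ∀ q ∈ K, ∃ f ∈ A, f p ≠ f q) :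
    ∃ h ∈ A, h p ≠ 0 ∧ ∀ x ∈ K, h x = 0 := by
  refine hK.induction_on (p := fun S => ∃ h ∈ A, h p ≠ 0 ∧ ∀ x ∈ S, h x = 0)
    ⟨1, hA.one_mem, one_ne_zero, by simp⟩ ?_ ?_ ?_
  · rintro S T hST ⟨h, hh, hhp, hT⟩
    exact ⟨h, hh, hhp, fun x hx => hT x (hST hx)⟩
  · rintro S T ⟨h, hh, hhp, hS⟩ ⟨h', hh', hhp', hT⟩
    refine ⟨_, hA.mul_mem h hh h' hh', mul_ne_zero hhp hhp', ?_⟩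
    rintro x (hx | hx)
    · simp [hS x hx]
    · simp [hT x hx]
  · intro q hq
    obtain ⟨f, hf, hfpq⟩ := hp q hq
    obtain ⟨h, hh, hhp, hev⟩ := hA.exists_ne_zero_eventually_eq_zero hf hfpq
    exact ⟨_, mem_nhdsWithin_of_mem_nhds hev, h, hh, hhp, fun x hx => hx⟩

/-- A countable saturated system of functions defines a compact second countable factor. -/
theorem Saturated.exists_factor [CompactSpace X] (hA : Saturated G₀ A) (hc : A.Countable) :
    ∃ (X₀ : Type u) (_ : TopologicalSpace X₀) (_ : MulAction G₀ X₀) (π : X → X₀),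
      CompactSpace X₀ ∧ T2Space X₀ ∧ SecondCountableTopology X₀ ∧ ContinuousConstSMul G₀ X₀ ∧
      Continuous π ∧ Function.Surjective π ∧ (∀ (g : G₀) x, π ((g : G) • x) = g • π x) ∧
      (∀ f ∈ A, ∃ f₀ : X₀ → ℝ, Continuous f₀ ∧ ∀ x, f₀ (π x) = f x) ∧
      ∀ U : Set X₀, IsOpen U → ∀ p, π p ∈ U → ∃ f ∈ A, f p ≠ 0 ∧ ∀ x, f x ≠ 0 → π x ∈ U := by
  let s : Setoid X := functionSetoid A
  let act : MulAction G₀ (Quotient s) :=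
    { smul := fun g => Quotient.map (fun x => (g : G) • x)
        fun x y h f hf => h _ (hA.translate_mem g g.2 f hf)
      one_smul := by
        rintro ⟨x⟩
        exact congrArg (Quotient.mk s) (one_smul G x)
      mul_smul := by
        rintro g h ⟨x⟩
        exact congrArg (Quotient.mk s) (mul_smul (g : G) (h : G) x) }
  have : Countable A := hc.to_subtype
  let j : Quotient s → A → ℝ := fun z f => Quotient.lift f.1 (fun x y (h : s x y) => h f.1 f.2) z
  have hj : Continuous j := continuous_pi fun f => f.1.continuous.quotient_lift _
  have hinj : Function.Injective j := by
    rintro ⟨x⟩ ⟨y⟩ h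
    exact Quotient.sound fun f hf => congrFun h ⟨f, hf⟩
  have hequiv : ∀ (g : G₀) (x : X), Quotient.mk s ((g : G) • x) = g • Quotient.mk s x :=
    fun _ _ => rfl
  refine ⟨Quotient s, inferInstance, act, Quotient.mk s, inferInstance,
    T2Space.of_injective_continuous hinj hj,
    (hj.isClosedEmbedding hinj).isEmbedding.secondCountableTopology,
    ⟨fun g => (continuous_quotient_mk'.comp (continuous_const_smul (g : G))).quotient_lift _⟩,
    continuous_quotient_mk', Quotient.mk_surjective, hequiv, fun f hf => ?_,
    fun U hU p hp => ?_⟩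
  · exact ⟨fun z => j z ⟨f, hf⟩, (continuous_apply _).comp hj, fun x => rfl⟩
  · obtain ⟨h, hh, hhp, hz⟩ := hA.exists_ne_zero_eq_zero_on (p := p)
      (hU.preimage continuous_quotient_mk').isClosed_compl.isCompact (by
        intro q hq
        by_contra! hcon
        refine hq ?_
        change Quotient.mk s q ∈ U
        rwa [← Quotient.sound (s := s) (a := p) (b := q) hcon])
    refine ⟨h, hh, hhp, fun x hx => ?_⟩
    by_contra hn
    exact hx (hz x hn)

end FunctionQuotient

/-! ### Reduction to the second countable case -/

section CountableReduction

variable {G X : Type*} [Group G]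

theorem coe_mem_faceGroup {G₀ : Subgroup G} {d : ℕ} {γ : Config d G₀}
    (hγ : γ ∈ faceGroup G₀ d) : (fun ω => (γ ω : G)) ∈ faceGroup G d := by
  have : faceGroup G₀ d ≤ (faceGroup G d).comap (G₀.subtype.compLeft (Cube d)) := by
    refine (Subgroup.closure_le _).mpr ?_
    rintro _ ⟨g, i, rfl⟩
    have : G₀.subtype.compLeft (Cube d) (faceElement g (hyperface i 1)) =
        faceElement (g : G) (hyperface i 1) := by
      ext ω
      by_cases hω : ω ∈ hyperface i 1 <;> simp [faceElement, hω]
    simpa [this] using faceElement_mem_faceGroup (g : G) i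
  exact this hγ

theorem exists_finset_lift_of_mem_faceGroup {d : ℕ} {γ : Config d G} (hγ : γ ∈ faceGroup G d) :
    ∃ s : Finset G, ∀ G₀ : Subgroup G, (s : Set G) ⊆ G₀ →
      ∃ γ₀ ∈ faceGroup G₀ d, ∀ ω, (γ₀ ω : G) = γ ω := by
  classical
  induction hγ using Subgroup.closure_induction with
  | mem γ h =>
    obtain ⟨g, i, rfl⟩ := h
    refine ⟨{g}, fun G₀ hG₀ => ?_⟩
    have hg : g ∈ G₀ := hG₀ (by simp)
    refine ⟨_, faceElement_mem_faceGroup ⟨g, hg⟩ i, fun ω => ?_⟩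
    by_cases hω : ω ∈ hyperface i 1 <;> simp [faceElement, hω]
  | one => exact ⟨∅, fun G₀ _ => ⟨1, one_mem _, fun ω => rfl⟩⟩
  | mul γ δ _ _ hγ hδ =>
    obtain ⟨s, hs⟩ := hγ
    obtain ⟨t, ht⟩ := hδ
    refine ⟨s ∪ t, fun G₀ hG₀ => ?_⟩
    rw [Finset.coe_union, Set.union_subset_iff] at hG₀
    obtain ⟨γ₀, hγ₀, h⟩ := hs G₀ hG₀.1
    obtain ⟨δ₀, hδ₀, h'⟩ := ht G₀ hG₀.2
    exact ⟨_, mul_mem hγ₀ hδ₀, fun ω => by simp [h, h']⟩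
  | inv γ _ hγ =>
    obtain ⟨s, hs⟩ := hγ
    refine ⟨s, fun G₀ hG₀ => ?_⟩
    obtain ⟨γ₀, hγ₀, h⟩ := hs G₀ hG₀
    exact ⟨_, inv_mem hγ₀, fun ω => by simp [h]⟩

variable [TopologicalSpace X] [CompactSpace X] [MulAction G X] [ContinuousConstSMul G X]

/-- By minimality the translates of the open set `f ≠ 0` cover `X`; finitely many suffice. -/
theorem exists_finset_forall_exists_smul_ne_zero [MulAction.IsMinimal G X] (f : C(X, ℝ))
    (hf : ∃ x, f x ≠ 0) : ∃ s : Finset G, ∀ x, ∃ g ∈ s, f (g • x) ≠ 0 := by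
  classical
  obtain ⟨I, hI⟩ := isCompact_univ.exists_finite_cover_smul G
    (isOpen_ne_fun f.continuous continuous_const) hf
  refine ⟨I.image (·⁻¹), fun x => ?_⟩
  obtain ⟨g, hg, y, hy, hyx⟩ := Set.mem_iUnion₂.mp (hI (Set.mem_univ x))
  refine ⟨g⁻¹, Finset.mem_image_of_mem _ hg, ?_⟩
  rw [← hyx]
  simpa using hy

omit [CompactSpace X] [ContinuousConstSMul G X] in
theorem exists_finset_forall_exists_faceGroup {d : ℕ} {c : Config d X}
    (hc : c ∈ dynCubes G X d) (ψ : Cube d → C(X, ℝ)) (hψ : ∀ ω, ψ ω (c ω) ≠ 0) :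
    ∃ s : Finset G, ∀ G₀ : Subgroup G, (s : Set G) ⊆ G₀ →
      ∃ γ₀ ∈ faceGroup G₀ d, ∃ y : X, ∀ ω, ψ ω ((γ₀ ω : G) • y) ≠ 0 := by
  rw [dynCubes_eq_closure_faceGroup] at hc
  have hopen : IsOpen {c : Config d X | ∀ ω, ψ ω (c ω) ≠ 0} := by
    simp only [Set.ofPred_forall]
    exact isOpen_iInter_of_finite fun ω =>
      isOpen_ne_fun ((ψ ω).continuous.comp (continuous_apply ω)) continuous_const
  obtain ⟨_, hne, γ, hγ, y, rfl⟩ := mem_closure_iff.mp hc _ hopen hψ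
  obtain ⟨s, hs⟩ := exists_finset_lift_of_mem_faceGroup hγ
  refine ⟨s, fun G₀ hG₀ => ?_⟩
  obtain ⟨γ₀, hγ₀, h⟩ := hs G₀ hG₀
  refine ⟨γ₀, hγ₀, y, fun ω => ?_⟩
  rw [h]
  exact hne ω

/-- A countable subgroup and a countable saturated system of functions which witness minimality
and membership of a given configuration in the dynamical cubes. -/
theorem exists_countable_subsystem [MulAction.IsMinimal G X] {d : ℕ} {c : Config d X}
    (hc : c ∈ dynCubes G X d) (F : Cube d → C(X, ℝ)) :
    ∃ (G₀ : Subgroup G) (A : Set C(X, ℝ)), A.Countable ∧ Saturated G₀ A ∧ (∀ ω, F ω ∈ A) ∧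
      (∀ f ∈ A, (∃ x, f x ≠ 0) → ∀ x, ∃ g ∈ G₀, f (g • x) ≠ 0) ∧
      ∀ ψ : Cube d → C(X, ℝ), (∀ ω, ψ ω ∈ A) → (∀ ω, ψ ω (c ω) ≠ 0) →
        ∃ γ₀ ∈ faceGroup G₀ d, ∃ y : X, ∀ ω, ψ ω ((γ₀ ω : G) • y) ≠ 0 := by
  have hmin : ∀ f : C(X, ℝ), ∃ s : Finset G, (∃ x, f x ≠ 0) → ∀ x, ∃ g ∈ s, f (g • x) ≠ 0 := by
    intro f
    by_cases hf : ∃ x, f x ≠ 0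
    · obtain ⟨s, hs⟩ := exists_finset_forall_exists_smul_ne_zero (G := G) f hf
      exact ⟨s, fun _ => hs⟩
    · exact ⟨∅, fun h => absurd h hf⟩
  have hcube : ∀ ψ : Cube d → C(X, ℝ), ∃ s : Finset G, (∀ ω, ψ ω (c ω) ≠ 0) →
      ∀ G₀ : Subgroup G, (s : Set G) ⊆ G₀ →
        ∃ γ₀ ∈ faceGroup G₀ d, ∃ y : X, ∀ ω, ψ ω ((γ₀ ω : G) • y) ≠ 0 := by
    intro ψ
    by_cases hψ : ∀ ω, ψ ω (c ω) ≠ 0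
    · obtain ⟨s, hs⟩ := exists_finset_forall_exists_faceGroup hc ψ hψ
      exact ⟨s, fun _ => hs⟩
    · exact ⟨∅, fun h => absurd h hψ⟩
  -- `m f` and `k ψ` are finite sets of group elements witnessing minimality and the cube condition;
  -- they are empty where the nonvanishing hypothesis fails.
  choose m hm using hmin
  choose k hk using hcube
  let ops : G ⊕ C(X, ℝ) → G ⊕ C(X, ℝ) → Set (G ⊕ C(X, ℝ)) := fun u v =>
    match u, v with
    | .inl g, .inl h => {.inl (g * h), .inl g⁻¹}
    | .inl g, .inr f => {.inr (translate g f)}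
    | .inr f, .inr f' => {.inr (f * f')} ∪
        Set.range (fun r : ℚ => .inr ((f - ContinuousMap.const X (r : ℝ)) ⊔ 0)) ∪
        Set.range (fun r : ℚ => .inr ((ContinuousMap.const X (r : ℝ) - f) ⊔ 0)) ∪
        Sum.inl '' (m f : Set G)
    | .inr _, .inl _ => ∅
  have hops : ∀ u v, (ops u v).Countable := by
    rintro (g | f) (h | f')
    · exact (Set.toFinite _).countable
    · exact Set.countable_singleton _
    · exact Set.countable_empty
    · exact (((Set.countable_singleton _).union (Set.countable_range _)).union
        (Set.countable_range _)).union ((m f).countable_toSet.image _)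
  -- Group elements and functions are closed up together: two slots feed the binary operations, one
  -- slot per vertex feeds `k`. Group elements in vertex slots are read as the function `0`.
  let w : (Fin 2 ⊕ Cube d → G ⊕ C(X, ℝ)) → Set (G ⊕ C(X, ℝ)) := fun φ =>
    ops (φ (.inl 0)) (φ (.inl 1)) ∪
      Sum.inl '' (k fun ω => Sum.elim (fun _ => 0) id (φ (.inr ω)) : Set G)
  obtain ⟨S, hS₀, hScount, hS⟩ := exists_countable_superset_closed w
    (fun φ => (hops _ _).union ((Finset.countable_toSet _).image _))
    (S₀ := {.inl 1, .inr 1} ∪ Set.range fun ω => Sum.inr (F ω))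
    ((Set.toFinite _).countable.union (Set.countable_range _))
  have hSops : ∀ u ∈ S, ∀ v ∈ S, ops u v ⊆ S := by
    intro u hu v hv
    refine Set.Subset.trans Set.subset_union_left (hS (Sum.elim ![u, v] fun _ => u) ?_)
    rintro (i | ω)
    · fin_cases i
      · exact hu
      · exact hv
    · exact hu
  have hone : Sum.inl 1 ∈ S := hS₀ (by simp)
  have hone' : Sum.inr 1 ∈ S := hS₀ (by simp)
  let G₀ : Subgroup G :=
    { carrier := {g | Sum.inl g ∈ S}
      one_mem' := hone
      mul_mem' := fun {g h} hg hh => hSops _ hg _ hh (Or.inl rfl)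
      inv_mem' := fun {g} hg => hSops _ hg _ hg (Or.inr rfl) }
  refine ⟨G₀, {f | Sum.inr f ∈ S}, hScount.preimage Sum.inr_injective,
    ⟨hone', ?_, ?_, ?_, ?_⟩, ?_, ?_, ?_⟩
  · exact fun f hf f' hf' => hSops _ hf _ hf' (Or.inl (Or.inl (Or.inl rfl)))
  · exact fun f hf r => hSops _ hf _ hf (Or.inl (Or.inl (Or.inr ⟨r, rfl⟩)))
  · exact fun f hf r => hSops _ hf _ hf (Or.inl (Or.inr ⟨r, rfl⟩))
  · exact fun g hg f hf => hSops _ hg _ hf rfl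
  · exact fun ω => hS₀ (Or.inr ⟨ω, rfl⟩)
  · intro f hf hne x
    obtain ⟨g, hg, hgx⟩ := hm f hne x
    exact ⟨g, hSops _ hf _ hf (Or.inr ⟨g, hg, rfl⟩), hgx⟩
  · intro ψ hψ hψc
    refine hk ψ hψc G₀ fun g hg => ?_
    refine hS (Sum.elim (fun _ => Sum.inr 1) fun ω => Sum.inr (ψ ω)) ?_ (Or.inr ⟨g, hg, rfl⟩)
    rintro (i | ω)
    · exact hone'
    · exact hψ ω

theorem cubesAt_subset_faceOrbitClosure [T2Space X] [MulAction.IsMinimal G X]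
    (hsym : OrbitClosuresSymm G X) (d : ℕ) (x : X) :
    cubesAt G d x ⊆ faceOrbitClosure G d x := by
  rintro c ⟨hc, hcx⟩
  refine mem_closure_iff_nhds.mpr fun V hV => ?_
  rw [nhds_pi, Filter.mem_pi] at hV
  -- The basic neighbourhood is replaced by the nonvanishing sets of Urysohn functions `F ω`, which
  -- can be put into the countable system.
  obtain ⟨I, -, U, hU, hUV⟩ := hV
  have hF : ∀ ω, ∃ f : C(X, ℝ), f (c ω) ≠ 0 ∧ ∀ y, f y ≠ 0 → y ∈ U ω := by
    intro ω
    obtain ⟨f, hf0, hf1, -⟩ := exists_continuous_zero_one_of_isClosed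
      (isOpen_interior (s := U ω)).isClosed_compl (isClosed_singleton (x := c ω))
      (Set.disjoint_singleton_right.mpr fun h => h (mem_interior_iff_mem_nhds.mpr (hU ω)))
    refine ⟨f, by simp [hf1 rfl], fun y hy => ?_⟩
    by_contra hn
    exact hy (hf0 fun h => hn (interior_subset h))
  choose F hFc hFU using hF
  obtain ⟨G₀, A, hAc, hA, hFA, hmin, hcubes⟩ := exists_countable_subsystem hc F
  obtain ⟨X₀, _, _, π, _, _, _, _, hπ, hsurj, hequiv, hlift, hbasis⟩ := hA.exists_factor hAc
  have : MulAction.IsMinimal G₀ X₀ := by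
    refine ⟨fun z => dense_iff_inter_open.mpr fun W hW hWne => ?_⟩
    obtain ⟨p, rfl⟩ := hsurj z
    obtain ⟨z', hz'⟩ := hWne
    obtain ⟨q, rfl⟩ := hsurj z'
    obtain ⟨f, hf, hfq, hfW⟩ := hbasis W hW q hz'
    obtain ⟨g, hg, hgp⟩ := hmin f hf ⟨q, hfq⟩ p
    exact ⟨π (g • p), hfW _ hgp, ⟨g, hg⟩, (hequiv ⟨g, hg⟩ p).symm⟩
  have hc₀ : (fun ω => π (c ω)) ∈ cubesAt G₀ d (π x) := by
    refine ⟨?_, congrArg π hcx⟩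
    rw [dynCubes_eq_closure_faceGroup]
    refine mem_closure_iff_nhds.mpr fun W hW => ?_
    rw [nhds_pi, Filter.mem_pi] at hW
    obtain ⟨I, -, T, hT, hTW⟩ := hW
    choose ψ hψA hψc hψT using fun ω => hbasis (interior (T ω)) isOpen_interior (c ω)
      (mem_interior_iff_mem_nhds.mpr (hT ω))
    obtain ⟨γ, hγ, y, hy⟩ := hcubes ψ hψA hψc
    refine ⟨γ • constConfig d (π y), hTW fun ω _ => ?_, γ, hγ, π y, rfl⟩
    have := interior_subset (hψT ω _ (hy ω))
    rwa [hequiv] at this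
  have hmem := cubesAt_subset_faceOrbitClosure_of_secondCountable
    (hsym.of_factor hπ hsurj hequiv) d (π x) hc₀
  -- Each `F ω` factors through `π`, so an approximation in `X₀` by `G₀` is also one in `X`, with
  -- the same group elements and base point `x`.
  choose F₀ hF₀ hF₀π using fun ω => hlift (F ω) (hFA ω)
  have hopen : IsOpen {c : Config d X₀ | ∀ ω, F₀ ω (c ω) ≠ 0} := by
    simp only [Set.ofPred_forall]
    exact isOpen_iInter_of_finite fun ω =>
      isOpen_ne_fun ((hF₀ ω).comp (continuous_apply ω)) continuous_const
  obtain ⟨_, hne, ⟨γ, hγ⟩, rfl⟩ := mem_closure_iff.mp hmem _ hopen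
    (fun ω => by rw [hF₀π]; exact hFc ω)
  refine ⟨_, hUV fun ω _ => ?_, smul_mem_orbit_subgroup (coe_mem_faceGroup hγ) (constConfig d x)⟩
  refine hFU ω _ ?_
  have : F₀ ω (γ ω • π x) ≠ 0 := hne ω
  rwa [← hequiv, hF₀π] at this

end CountableReduction

end CubeDynamics

theorem mainTheorem10 {G : Type*} [Group G] [TopologicalSpace G] [IsTopologicalGroup G] [T2Space G]
    {X : Type*} [TopologicalSpace X] [CompactSpace X] [T2Space X]
    [MulAction G X] [ContinuousSMul G X]
    (hmin : MulAction.IsMinimal G X) (hdistal : CubeDynamics.IsDistal G X)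
    (d : ℕ) (hd : 1 ≤ d) (x : X) :
    CubeDynamics.faceOrbitClosure G d x = CubeDynamics.cubesAt G d x ∧
      CubeDynamics.puncturedFaceOrbitClosure G d x = CubeDynamics.puncturedCubesAt G d x := by
  have h : CubeDynamics.faceOrbitClosure G d x = CubeDynamics.cubesAt G d x :=
    (CubeDynamics.faceOrbitClosure_subset_cubesAt d x).antisymm
      (CubeDynamics.cubesAt_subset_faceOrbitClosure (.of_isDistal hdistal) d x)
  exact ⟨h, congrArg (CubeDynamics.forgetZero '' ·) h⟩
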